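/- Let $K$ be an algebraically closed field and let $X$ be a variety over $K$, that is, an integral separated scheme of finite type over $K$. Let $\Phi: X \dashrightarrow X$ be a dominant rational self-map of $X$ over $K$, and suppose that for some integer $k \ge 1$ the iterate $\Phi^k$ is regular, i.e. is represented by a morphism $X \to X$. Then there exist a normal variety $\hat X$ over $K$, a birational $K$-morphism $\pi: \hat X \to X$ (a morphism which restricts to an isomorphism from a dense open subset of $\hat X$ onto a dense open subset of $X$), and a $K$-morphism $F: \hat X \to \hat X$ such that $$\pi \circ F = \Phi \circ \pi$$ as rational maps $\hat X \dashrightarrow X$. Moreover, if $X$ is proper over $K$, then $\pi$ can be taken to be proper (so that $\hat X$ is proper over $K$ as well). -/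

import Mathlib

open CategoryTheory AlgebraicGeometry

universe u

/-- A variety over a field `K`: an integral separated scheme of finite type over `K`. -/
structure Variety (K : Type u) [Field K] where
  /-- The underlying scheme. -/
  toScheme : Scheme.{u}
  /-- The structure morphism to `Spec K`. -/
  [overSpec : toScheme.Over (Spec (CommRingCat.of K))]
  [isIntegral : IsIntegral toScheme]
  [isSeparated : IsSeparated (toScheme ↘ Spec (CommRingCat.of K))]
  [locallyOfFiniteType : LocallyOfFiniteType (toScheme ↘ Spec (CommRingCat.of K))]
  [quasiCompact : QuasiCompact (toScheme ↘ Spec (CommRingCat.of K))]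

attribute [instance] Variety.overSpec Variety.isIntegral Variety.isSeparated
  Variety.locallyOfFiniteType Variety.quasiCompact

/-- A scheme is normal if all its local rings are integrally closed domains. -/
def IsNormalScheme (X : Scheme.{u}) : Prop :=
  ∀ x : X, IsDomain (X.presheaf.stalk x) ∧ IsIntegrallyClosed (X.presheaf.stalk x)

/-- A morphism `f : X ⟶ Y` is birational if it restricts to an isomorphism from a dense open
subscheme of `X` onto a dense open subscheme of `Y`. -/
class IsBirationalMorphism {X Y : Scheme.{u}} (f : X ⟶ Y) : Prop where
  exists_partialIso : ∃ e : Scheme.PartialIso X Y, e.iso.hom ≫ e.target.ι = e.source.ι ≫ f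

/-- A birational morphism is dominant, so that rational maps can be composed with it. -/
instance IsBirationalMorphism.isDominant {X Y : Scheme.{u}} (f : X ⟶ Y)
    [h : IsBirationalMorphism f] : IsDominant f := by
  obtain ⟨e, he⟩ := h.exists_partialIso
  have : IsDominant e.target.ι := AlgebraicGeometry.Opens.isDominant_ι e.dense_target
  have h2 : IsDominant (e.source.ι ≫ f) := he ▸ inferInstance
  exact IsDominant.of_comp e.source.ι f

/-- The `n`-th iterate of a dominant rational self-map. Here `f.comp g` is "first `f`, then `g`". -/
noncomputable def rationalIterate {X : Scheme.{u}} [IrreducibleSpace X] (f : X ⤏ X)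
    [f.IsDominant] : ℕ → (X ⤏ X)
  | 0 => Scheme.RationalMap.id X
  | n + 1 => f.comp (rationalIterate f n)

/-- A rational map is regular if it is (the class of) an everywhere defined morphism. -/
def IsRegularRationalMap {X Y : Scheme.{u}} (f : X ⤏ Y) : Prop :=
  ∃ g : X ⟶ Y, Scheme.Hom.toRationalMap g = f

/-! Write `k = m + 1`, let `f` be the morphism representing `Φ^k` and `η` the generic point of `X`.
The tuple `(η, Φη, …, Φ^m η)` is a point `g` of the fibre power `P = X^k`. The shift `φ (x₀, …, x_m)
= (x₁, …, x_m, f x₀)` is defined on all of `P` and moves `g` the way `Φ` moves `η`. Take for `X̂`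
the normalization of `P` in `g`, that is, the normalized closure of the graph of `(Φ, …, Φ^m)`. Then
`φ` lifts to `F` (`exists_normalization_lift`), and `π` is the zeroth coordinate. As `η` lifts to a
dense point of `X̂`, `π` is birational (`isBirationalMorphism_of_generic_section`), and `π ∘ F = Φ ∘
π` need only be checked at that point.

That `X̂` is again of finite type rests on finiteness of normalization over a perfect field
(`isFinite_fromNormalization`): Noether normalization reduces to a polynomial ring, whose finite
Frobenius takes care of inseparability. -/

/-! ### Finiteness of integral closures over a perfect field -/

/-- If `g ∘ f` is finite with Noetherian source and `g` is injective, then `f` is finite. -/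
theorem RingHom.Finite.of_comp_finite_of_injective {R S T : Type*} [CommRing R] [CommRing S]
    [CommRing T] [IsNoetherianRing R] {f : R →+* S} {g : S →+* T} (h : (g.comp f).Finite)
    (hg : Function.Injective g) : f.Finite := by
  algebraize [f, g, g.comp f]
  have : Module.Finite R T := h
  exact Module.Finite.of_injective (IsScalarTower.toAlgHom R S T).toLinearMap hg

/-- The Frobenius of a polynomial ring in finitely many variables over a perfect ring is finite. -/
theorem MvPolynomial.finite_frobenius (K σ : Type*) [Field K] [Finite σ] (p : ℕ) [ExpChar K p]
    [PerfectRing K p] : (frobenius (MvPolynomial σ K) p).Finite := by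
  have hint : (frobenius (MvPolynomial σ K) p).IsIntegral := fun x ↦
    ⟨Polynomial.X ^ p - Polynomial.C x, Polynomial.monic_X_pow_sub_C _ (expChar_pos K p).ne',
      by simp [frobenius_def]⟩
  refine hint.to_finite (RingHom.FiniteType.of_comp_finiteType (f := C) ?_)
  -- Perfectness enters here: Frobenius is onto `K`, so the variables still generate over the
  -- twisted constants.
  have : (frobenius (MvPolynomial σ K) p).comp C = C.comp (frobenius K p) := by
    ext x; simp [frobenius_def]
  rw [this]
  refine RingHom.FiniteType.comp (RingHom.finiteType_algebraMap.mpr inferInstance)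
    (RingHom.FiniteType.of_surjective _ (bijective_frobenius K p).2)

theorem RingHom.Finite.iterateFrobenius {R : Type*} [CommRing R] {p : ℕ} [ExpChar R p]
    (h : (frobenius R p).Finite) (n : ℕ) : (iterateFrobenius R p n).Finite := by
  induction n with
  | zero => rw [iterateFrobenius_zero]; exact RingHom.Finite.id R
  | succ n ih =>
    rw [iterateFrobenius_add, iterateFrobenius_one]
    exact ih.comp h

/-- A Noetherian normal domain whose Frobenius is finite has finite integral closure in
every finite extension of its fraction field. -/
theorem IsIntegralClosure.finite_of_finite_frobenius (R F L : Type*) [CommRing R] [IsDomain R]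
    [IsIntegrallyClosed R] [IsNoetherianRing R] [Field F] [Algebra R F] [IsFractionRing R F]
    [Field L] [Algebra F L] [Algebra R L] [IsScalarTower R F L] [FiniteDimensional F L]
    (p : ℕ) [ExpChar R p] (hfrob : (frobenius R p).Finite) :
    Module.Finite R (integralClosure R L) := by
  have : ExpChar F p := expChar_of_injective_algebraMap (IsFractionRing.injective R F) p
  have : ExpChar L p := expChar_of_injective_algebraMap (algebraMap F L).injective p
  -- The separable part is classical; raising to the power `p ^ e` then pushes the integral closure
  -- in `L` injectively into the one in `E`. In characteristic zero `p = 1`.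
  let E := separableClosure F L
  have : ExpChar E p := expChar_of_injective_algebraMap (algebraMap F E).injective p
  have : IsScalarTower R E L := .of_algebraMap_eq fun x ↦ by
    rw [IsScalarTower.algebraMap_apply R F L, IsScalarTower.algebraMap_apply R F E]; rfl
  have : Module.Finite R (integralClosure R E) := IsIntegralClosure.finite R F E _
  let e := IsPurelyInseparable.exponent E L
  let T : Subalgebra R L := (integralClosure R E).map (IsScalarTower.toAlgHom R E L)
  have : Module.Finite R T := Module.Finite.equiv
    ((integralClosure R E).equivMapOfInjective _ (algebraMap E L).injective).toLinearEquiv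
  have hmem (x : integralClosure R L) :
      (iterateFrobenius L p e).comp (integralClosure R L).val.toRingHom x ∈ T := by
    obtain ⟨y, hy⟩ := IsPurelyInseparable.exponent_def' E p (x : L)
    refine ⟨y, ?_, hy⟩
    have : IsIntegral R (algebraMap E L y) := hy ▸ x.2.pow _
    exact (isIntegral_algebraMap_iff (algebraMap E L).injective).mp this
  let ψ : integralClosure R L →+* T := RingHom.codRestrict _ T hmem
  have hψ : Function.Injective ψ := fun x y h ↦
    Subtype.ext (iterateFrobenius_inj L p e (congrArg Subtype.val h))
  have : (ψ.comp (algebraMap R (integralClosure R L))).Finite := by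
    have h2 : ψ.comp (algebraMap R (integralClosure R L)) =
        (algebraMap R T).comp (iterateFrobenius R p e) := by
      ext x
      change iterateFrobenius L p e (algebraMap R L x) = algebraMap R L (iterateFrobenius R p e x)
      rw [RingHom.map_iterateFrobenius]
    rw [h2]
    exact RingHom.Finite.comp (RingHom.finite_algebraMap.mpr ‹_›) (hfrob.iterateFrobenius e)
  exact RingHom.finite_algebraMap.mp (this.of_comp_finite_of_injective hψ)

/-- Finiteness of the normalization of an affine variety over a perfect field. -/
theorem Algebra.FiniteType.finite_integralClosure (K A L : Type*) [Field K] [PerfectField K]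
    [CommRing A] [IsDomain A] [Algebra K A] [Algebra.FiniteType K A] [Field L] [Algebra A L]
    [IsFractionRing A L] : Module.Finite A (integralClosure A L) := by
  obtain ⟨p, _⟩ := ExpChar.exists K
  obtain ⟨n, g, hg, hfin⟩ := exists_finite_inj_algHom_of_fg K A
  let R := MvPolynomial (Fin n) K
  have : ExpChar R p := expChar_of_injective_algebraMap (MvPolynomial.C_injective (Fin n) K) p
  let : Algebra R A := g.toRingHom.toAlgebra
  let : Algebra R L := ((algebraMap A L).comp g.toRingHom).toAlgebra
  have : IsScalarTower R A L := .of_algebraMap_eq' rfl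
  have : Module.Finite R A := hfin
  have : FaithfulSMul R A := (faithfulSMul_iff_algebraMap_injective R A).mpr hg
  have : FaithfulSMul R L := (faithfulSMul_iff_algebraMap_injective R L).mpr
    ((IsFractionRing.injective A L).comp hg)
  let F := FractionRing R
  let : Algebra F L := FractionRing.liftAlgebra R L
  have : IsScalarTower R F L := FractionRing.isScalarTower_liftAlgebra R L
  have : Algebra.IsAlgebraic F L := isAlgebraic_of_isFractionRing R A F L
  have : EssFiniteType A L := .of_isLocalization L (nonZeroDivisors A)
  have : EssFiniteType R L := .comp R A L
  have : EssFiniteType F L := .of_comp R F L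
  have : FiniteDimensional F L := by
    obtain ⟨s, hs⟩ := IntermediateField.fg_top F L
    have := IntermediateField.finiteDimensional_adjoin (K := F) (S := (s : Set L))
      fun x _ ↦ Algebra.IsIntegral.isIntegral x
    rw [hs] at this
    exact IntermediateField.topEquiv.toLinearEquiv.finiteDimensional
  have : PerfectRing K p := PerfectField.toPerfectRing p
  have : Module.Finite R (integralClosure R L) :=
    IsIntegralClosure.finite_of_finite_frobenius R F L p (MvPolynomial.finite_frobenius K (Fin n) p)
  let f : integralClosure R L →ₗ[R] integralClosure A L :=
    { toFun x := ⟨x, (show IsIntegral R (x : L) from x.2).tower_top⟩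
      map_add' _ _ := rfl
      map_smul' r x := Subtype.ext (by simp [Algebra.smul_def, IsScalarTower.algebraMap_apply R A L]) }
  have : Module.Finite R (integralClosure A L) := Module.Finite.of_surjective f fun x ↦
    ⟨⟨x, isIntegral_trans (R := R) (A := A) (x : L) x.2⟩, rfl⟩
  exact Module.Finite.of_restrictScalars_finite R A _

/-- Let `A` be a finite type algebra over a perfect field and let `A → L` be a homomorphism to a
field that is surjective on stalks. Then the integral closure of `A` in `L` is finite over `A`. -/
theorem RingHom.SurjectiveOnStalks.finite_integralClosure (K A L : Type*) [Field K] [PerfectField K]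
    [CommRing A] [Algebra K A] [Algebra.FiniteType K A] [Field L] [Algebra A L]
    (h : (algebraMap A L).SurjectiveOnStalks) : Module.Finite A (integralClosure A L) := by
  let I := RingHom.ker (algebraMap A L)
  let : Algebra (A ⧸ I) L := (RingHom.kerLift (algebraMap A L)).toAlgebra
  have : IsScalarTower A (A ⧸ I) L := .of_algebraMap_eq' rfl
  have : I.IsPrime := RingHom.ker_isPrime _
  have hinj : Function.Injective (algebraMap (A ⧸ I) L) := RingHom.kerLift_injective _
  have : FaithfulSMul (A ⧸ I) L := (faithfulSMul_iff_algebraMap_injective _ L).mpr hinj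
  have : IsFractionRing (A ⧸ I) L := by
    refine IsFractionRing.of_field _ L fun z ↦ ?_
    -- Surjectivity on the stalk at the zero ideal writes every element of `L` as a fraction from `A
    -- ⧸ I`.
    obtain ⟨x, r, c, hc, hr, hx⟩ :=
      RingHom.surjectiveOnStalks_iff_forall_ideal.mp h ⊥ bot_ne_top z
    rw [Ideal.mem_bot] at hc hr
    refine ⟨Ideal.Quotient.mk I x, Ideal.Quotient.mk I r, ?_⟩
    change z = algebraMap A L x / algebraMap A L r
    rw [eq_div_iff hr, mul_comm]
    exact mul_left_cancel₀ hc (by rw [← mul_assoc, hx])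
  have := Algebra.FiniteType.finite_integralClosure K (A ⧸ I) L
  have : Module.Finite A (integralClosure (A ⧸ I) L) := Module.Finite.trans (A ⧸ I) _
  let f : integralClosure (A ⧸ I) L →ₗ[A] integralClosure A L :=
    { toFun x := ⟨x, isIntegral_trans (R := A) (A := A ⧸ I) (x : L) x.2⟩
      map_add' _ _ := rfl
      map_smul' r x := Subtype.ext (by
        simp [Algebra.smul_def, IsScalarTower.algebraMap_apply A (A ⧸ I) L]) }
  exact Module.Finite.of_surjective f fun x ↦
    ⟨⟨x, (show _root_.IsIntegral A (x : L) from x.2).tower_top⟩, rfl⟩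

/-- The integral closure of a ring in a field is an integrally closed domain. -/
theorem isIntegrallyClosed_integralClosure (A L : Type*) [CommRing A] [Field L] [Algebra A L] :
    IsIntegrallyClosed (integralClosure A L) := by
  let C := integralClosure A L
  let : Algebra (FractionRing C) L := FractionRing.liftAlgebra C L
  have : IsScalarTower C (FractionRing C) L := FractionRing.isScalarTower_liftAlgebra C L
  refine (isIntegrallyClosed_iff (FractionRing C)).mpr fun {x} hx ↦ ?_
  have h : IsIntegral C (algebraMap (FractionRing C) L x) := hx.algebraMap
  refine ⟨⟨_, isIntegral_trans (R := A) (A := C) _ h⟩, ?_⟩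
  apply (algebraMap (FractionRing C) L).injective
  rw [← IsScalarTower.algebraMap_apply C (FractionRing C) L]
  rfl

namespace AlgebraicGeometry

/-! ### Fibre powers -/

open Limits in
/-- Finite fibre powers of a morphism, with the properties they inherit. -/
theorem exists_fiberPower {S X : Scheme.{u}} (sX : X ⟶ S) (n : ℕ) :
    ∃ (P : Scheme.{u}) (s : P ⟶ S) (pr : Fin n → (P ⟶ X)), (∀ i, pr i ≫ sX = s) ∧
      (∀ Q : MorphismProperty Scheme.{u}, Q.IsMultiplicative → Q.IsStableUnderBaseChange →
        Q sX → Q s) ∧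
      ∀ (T : Scheme.{u}) (t : T ⟶ S) (q : Fin n → (T ⟶ X)), (∀ i, q i ≫ sX = t) →
        ∃! l : T ⟶ P, l ≫ s = t ∧ ∀ i, l ≫ pr i = q i := by
  induction n with
  | zero =>
    refine ⟨S, 𝟙 S, Fin.elim0, fun i ↦ i.elim0, fun Q _ _ _ ↦ Q.id_mem S, fun T t q _ ↦
      ⟨t, ⟨Category.comp_id t, fun i ↦ i.elim0⟩, fun l hl ↦ by simpa using hl.1⟩⟩
  | succ n ih =>
    obtain ⟨P, s, pr, hpr, hQ, hlift⟩ := ih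
    refine ⟨pullback sX s, pullback.snd sX s ≫ s,
      Fin.cons (pullback.fst sX s) fun i ↦ pullback.snd sX s ≫ pr i, ?_, ?_, ?_⟩
    · intro i
      refine Fin.cases ?_ (fun i ↦ ?_) i
      · simpa using pullback.condition
      · simp [hpr]
    · intro Q _ _ h
      exact Q.comp_mem _ _ (Q.pullback_snd _ _ h) (hQ Q ‹_› ‹_› h)
    · intro T t q hq
      obtain ⟨l, ⟨hl, hl'⟩, huniq⟩ := hlift T t (fun i ↦ q i.succ) fun i ↦ hq i.succ
      refine ⟨pullback.lift (q 0) l ((hq 0).trans hl.symm), ⟨by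
        rw [pullback.lift_snd_assoc, hl], fun i ↦ ?_⟩, ?_⟩
      · refine Fin.cases ?_ (fun i ↦ ?_) i
        · exact pullback.lift_fst _ _ _
        · exact (pullback.lift_snd_assoc _ _ _ _).trans (hl' i)
      · rintro m ⟨hm, hm'⟩
        apply pullback.hom_ext
        · exact (hm' 0).trans (pullback.lift_fst _ _ _).symm
        · refine (huniq _ ⟨by simpa using hm, fun i ↦ ?_⟩).trans (pullback.lift_snd _ _ _).symm
          simpa using hm' i.succ

/-! ### Normalization in the spectrum of a field -/

theorem eq_bot_or_eq_top_of_isField {L : CommRingCat.{u}} (hL : IsField L) (V : (Spec L).Opens) :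
    V = ⊥ ∨ V = ⊤ := by
  let := hL.toField
  have : Subsingleton (Spec L) := inferInstanceAs (Subsingleton (PrimeSpectrum L))
  rcases V.1.eq_empty_or_nonempty with h | ⟨x, hx⟩
  · exact .inl (TopologicalSpace.Opens.ext h)
  · refine .inr (TopologicalSpace.Opens.ext (Set.eq_univ_of_forall fun y ↦ ?_))
    rwa [Subsingleton.elim y x]

theorem isField_Γ_of_nonempty {L : CommRingCat.{u}} (hL : IsField L) (V : (Spec L).Opens)
    [Nonempty V] : IsField Γ(Spec L, V) := by
  obtain rfl | rfl := eq_bot_or_eq_top_of_isField hL V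
  · exact (‹Nonempty (⊥ : (Spec L).Opens)›.some.2).elim
  · exact (Scheme.ΓSpecIso L).commRingCatIsoToRingEquiv.toMulEquiv.isField hL

theorem IsAffineOpen.isIntegrallyClosed_stalk {X : Scheme.{u}} {U : X.Opens} (hU : IsAffineOpen U)
    [IsDomain Γ(X, U)] [IsIntegrallyClosed Γ(X, U)] (x : U) :
    IsDomain (X.presheaf.stalk x.1) ∧ IsIntegrallyClosed (X.presheaf.stalk x.1) := by
  have := hU.isLocalization_stalk x
  have hle := (hU.primeIdealOf x).asIdeal.primeCompl_le_nonZeroDivisors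
  have hD : IsDomain (X.presheaf.stalk x.1) := IsLocalization.isDomain_of_le_nonZeroDivisors _ hle
  exact ⟨hD, isIntegrallyClosed_of_isLocalization _ _ hle⟩

section normalization

variable {P : Scheme.{u}} {L : CommRingCat.{u}} (g : Spec L ⟶ P) [QuasiCompact g]
  [QuasiSeparated g]

/-- The normalization of a scheme in a field is normal. -/
theorem isNormalScheme_normalization (hL : IsField L) : IsNormalScheme g.normalization := by
  intro x
  obtain ⟨_, ⟨U, hU, rfl⟩, hxU, -⟩ := P.isBasis_affineOpens.exists_subset_of_mem_open
    (Set.mem_univ (g.fromNormalization x)) isOpen_univ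
  -- `Spec L` is dense in the normalization, hence meets the preimage of `U`.
  have : Nonempty (g ⁻¹ᵁ U) := by
    obtain ⟨_, hy, y, rfl⟩ := g.toNormalization.denseRange.inter_open_nonempty _
      (g.fromNormalization ⁻¹ᵁ U).2 ⟨x, hxU⟩
    refine ⟨⟨y, ?_⟩⟩
    rw [← g.toNormalization_fromNormalization]
    exact hy
  let := (g.app U).hom.toAlgebra
  let := (isField_Γ_of_nonempty hL (g ⁻¹ᵁ U)).toField
  have := isIntegrallyClosed_integralClosure Γ(P, U) Γ(Spec L, g ⁻¹ᵁ U)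
  let e := (g.normalizationObjIso hU).commRingCatIsoToRingEquiv
  have : IsDomain Γ(g.normalization, g.fromNormalization ⁻¹ᵁ U) :=
    e.toMulEquiv.isDomain (integralClosure Γ(P, U) Γ(Spec L, g ⁻¹ᵁ U))
  have : IsIntegrallyClosed Γ(g.normalization, g.fromNormalization ⁻¹ᵁ U) :=
    .of_equiv (R := integralClosure Γ(P, U) Γ(Spec L, g ⁻¹ᵁ U)) e.symm
  exact (hU.preimage g.fromNormalization).isIntegrallyClosed_stalk ⟨x, hxU⟩

/-- The normalization of a scheme locally of finite type over a perfect field `K` in the residue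
field of one of its points is finite. -/
theorem isFinite_fromNormalization {K : Type u} [Field K] [PerfectField K]
    (hL : IsField L) (s : P ⟶ Spec (.of K)) [LocallyOfFiniteType s] [SurjectiveOnStalks g] :
    IsFinite g.fromNormalization where
  finite_app U hU := by
    let := (g.app U).hom.toAlgebra
    rw [g.fromNormalization_app hU]
    refine RingHom.Finite.comp (RingHom.Finite.of_surjective _
      (g.normalizationObjIso hU).symm.commRingCatIsoToRingEquiv.surjective) ?_
    refine RingHom.finite_algebraMap.mpr ?_
    by_cases hV : Nonempty (g ⁻¹ᵁ U)
    · have hVtop := (eq_bot_or_eq_top_of_isField hL (g ⁻¹ᵁ U)).resolve_left fun h ↦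
        (h ▸ hV.some.2 : hV.some.1 ∈ (⊥ : (Spec L).Opens))
      let := (isField_Γ_of_nonempty hL (g ⁻¹ᵁ U)).toField
      let := ((s.appLE ⊤ U le_top).hom.comp (Scheme.ΓSpecIso (.of K)).inv.hom).toAlgebra
      have : Algebra.FiniteType K Γ(P, U) := RingHom.FiniteType.comp
        (s.finiteType_appLE (isAffineOpen_top _) hU le_top)
        (.of_surjective _ (Scheme.ΓSpecIso (.of K)).symm.commRingCatIsoToRingEquiv.surjective)
      refine RingHom.SurjectiveOnStalks.finite_integralClosure K Γ(P, U) Γ(Spec L, g ⁻¹ᵁ U) ?_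
      have := HasRingHomProperty.appLE @SurjectiveOnStalks g ‹_› ⟨U, hU⟩
        ⟨g ⁻¹ᵁ U, hVtop ▸ isAffineOpen_top _⟩ le_rfl
      rwa [Scheme.Hom.appLE_eq_app] at this
    -- If `U` misses the point, its sections upstairs form the zero ring.
    · have hVbot := (eq_bot_or_eq_top_of_isField hL (g ⁻¹ᵁ U)).resolve_right fun h ↦ by
        let := hL.toField
        exact hV (h ▸ ⟨⟨IsLocalRing.closedPoint L, trivial⟩⟩)
      have : Subsingleton Γ(Spec L, g ⁻¹ᵁ U) := hVbot ▸ inferInstance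
      infer_instance

end normalization

/-! ### Rational maps and generic points -/

instance isDominant_fromSpecStalk_genericPoint (X : Scheme.{u}) [IrreducibleSpace X] :
    IsDominant (X.fromSpecStalk (genericPoint X)) := by
  refine ⟨?_⟩
  rw [DenseRange, Scheme.range_fromSpecStalk]
  refine Dense.mono (s₁ := {genericPoint X}) (by simp [specializes_rfl]) ?_
  exact dense_iff_closure_eq.mpr (genericPoint_closure (α := X))

instance isDominant_fromFunctionField {X Y : Scheme.{u}} [IrreducibleSpace X] (f : X ⤏ Y)
    [f.IsDominant] : IsDominant f.fromFunctionField := by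
  rw [← f.toRationalMap_representative, Scheme.RationalMap.fromFunctionField_toRationalMap]
  let U := f.representative.domain
  have h : genericPoint X ∈ U := (genericPoint_specializes _).mem_open U.2
    f.representative.dense_domain.nonempty.choose_spec
  have : IsDominant (U.fromSpecStalkOfMem (genericPoint X) h ≫ U.ι) := by
    rw [Scheme.Opens.fromSpecStalkOfMem_ι]; infer_instance
  have := IsDominant.of_comp_of_isOpenImmersion (U.fromSpecStalkOfMem (genericPoint X) h) U.ι
  exact inferInstanceAs (IsDominant (U.fromSpecStalkOfMem (genericPoint X) h ≫ _))

/-- A dominant morphism from the spectrum of a field factors through the generic point. -/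
theorem exists_eq_comp_fromSpecStalk_genericPoint {Y : Scheme.{u}} [IrreducibleSpace Y]
    {L : CommRingCat.{u}} (hL : IsField L) (q : Spec L ⟶ Y) [IsDominant q] :
    ∃ σ : Spec L ⟶ Spec Y.functionField, σ ≫ Y.fromSpecStalk (genericPoint Y) = q := by
  let := hL.toField
  have hgen : q (IsLocalRing.closedPoint L) = genericPoint Y := by
    refine ((genericPoint_spec Y).eq ?_).symm
    have : Subsingleton (Spec L) := inferInstanceAs (Subsingleton (PrimeSpectrum L))
    have hr : Set.range q = {q (IsLocalRing.closedPoint L)} := by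
      ext y
      constructor
      · rintro ⟨z, rfl⟩
        rw [Subsingleton.elim z (IsLocalRing.closedPoint L)]
        rfl
      · rintro rfl
        exact ⟨_, rfl⟩
    rw [isGenericPoint_def, ← hr]
    exact q.denseRange.closure_range
  suffices h : ∃ σ : Spec L ⟶ Spec (Y.presheaf.stalk (genericPoint Y)),
    σ ≫ Y.fromSpecStalk (genericPoint Y) = q from h
  rw [← hgen]
  exact ⟨_, Scheme.Spec_stalkClosedPointTo_fromSpecStalk q⟩

/-- Composition of rational maps in terms of generic points. -/
theorem fromFunctionField_comp {X Y Z : Scheme.{u}} [IrreducibleSpace X] [IrreducibleSpace Y]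
    (f : X ⤏ Y) [f.IsDominant] (g : Y ⤏ Z) {σ : Spec X.functionField ⟶ Spec Y.functionField}
    (hσ : σ ≫ Y.fromSpecStalk (genericPoint Y) = f.fromFunctionField) :
    (f.comp g).fromFunctionField = σ ≫ g.fromFunctionField := by
  obtain ⟨ψ, rfl⟩ := g.exists_rep
  rw [Scheme.RationalMap.comp_def, Scheme.RationalMap.fromFunctionField_toRationalMap,
    Scheme.RationalMap.fromFunctionField_toRationalMap]
  rw [← f.toRationalMap_representative, Scheme.RationalMap.fromFunctionField_toRationalMap] at hσ
  let φ := f.representative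
  let W := φ.domain.ι ''ᵁ φ.hom ⁻¹ᵁ ψ.domain
  have hW : genericPoint X ∈ W := (genericPoint_specializes _).mem_open W.2
    (φ.comp ψ).dense_domain.nonempty.choose_spec
  have hU : genericPoint X ∈ φ.domain := (genericPoint_specializes _).mem_open φ.domain.2
    φ.dense_domain.nonempty.choose_spec
  have hV : genericPoint Y ∈ ψ.domain := (genericPoint_specializes _).mem_open ψ.domain.2
    ψ.dense_domain.nonempty.choose_spec
  change W.fromSpecStalkOfMem _ hW ≫ (φ.domain.ι.isoImage _).inv ≫ φ.hom ∣_ ψ.domain ≫ ψ.hom =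
    σ ≫ ψ.domain.fromSpecStalkOfMem _ hV ≫ ψ.hom
  -- Both sides land in the open `ψ.domain`, so they can be compared in `Y`.
  have key : W.fromSpecStalkOfMem _ hW ≫ (φ.domain.ι.isoImage _).inv ≫ φ.hom ∣_ ψ.domain =
      σ ≫ ψ.domain.fromSpecStalkOfMem _ hV := by
    rw [← cancel_mono ψ.domain.ι]
    simp only [Category.assoc, Scheme.Opens.fromSpecStalkOfMem_ι, morphismRestrict_ι]
    rw [hσ]
    change _ = φ.domain.fromSpecStalkOfMem _ hU ≫ φ.hom
    have : W.fromSpecStalkOfMem _ hW ≫ (φ.domain.ι.isoImage (φ.hom ⁻¹ᵁ ψ.domain)).inv ≫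
        (φ.hom ⁻¹ᵁ ψ.domain).ι = φ.domain.fromSpecStalkOfMem _ hU := by
      rw [← cancel_mono φ.domain.ι]
      simp [W]
    rw [← this]
    simp
  simpa using congr($key ≫ ψ.hom)

theorem fromFunctionField_toRationalMap_hom {X Y : Scheme.{u}} [IrreducibleSpace X] (f : X ⟶ Y) :
    (Scheme.Hom.toRationalMap f).fromFunctionField = X.fromSpecStalk (genericPoint X) ≫ f :=
  Scheme.PartialMap.fromSpecStalkOfMem_toPartialMap _ _

theorem fromFunctionField_id (X : Scheme.{u}) [IrreducibleSpace X] :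
    (Scheme.RationalMap.id X).fromFunctionField = X.fromSpecStalk (genericPoint X) := by
  rw [fromFunctionField_toRationalMap_hom, Category.comp_id]

/-- The generic point of a scheme over `S`, composed with an `S`-rational map, is over `S`. -/
theorem fromFunctionField_comp_over {S X Y : Scheme.{u}} [IrreducibleSpace X] [X.Over S] [Y.Over S]
    (f : X ⤏ Y) [f.IsOver S] :
    f.fromFunctionField ≫ (Y ↘ S) = X.fromSpecStalk (genericPoint X) ≫ (X ↘ S) := by
  rw [← fromFunctionField_toRationalMap_hom, ← Scheme.RationalMap.isOver_iff.mp ‹f.IsOver S›]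
  obtain ⟨φ, rfl⟩ := f.exists_rep
  exact (Scheme.PartialMap.fromSpecStalkOfMem_compHom φ _ _ _).symm

instance isDominant_rationalIterate {X : Scheme.{u}} [IrreducibleSpace X] (f : X ⤏ X)
    [f.IsDominant] (n : ℕ) : (rationalIterate f n).IsDominant := by
  induction n with
  | zero => exact inferInstanceAs (Scheme.PartialMap.toRationalMap _).IsDominant
  | succ n ih => exact inferInstanceAs (f.comp _).IsDominant

instance isOver_rationalIterate {S X : Scheme.{u}} [IrreducibleSpace X] [X.Over S] (f : X ⤏ X)
    [f.IsDominant] [f.IsOver S] (n : ℕ) : (rationalIterate f n).IsOver S := by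
  induction n with
  | zero => exact inferInstanceAs ((Scheme.PartialMap.toRationalMap _).IsOver S)
  | succ n ih => exact inferInstanceAs ((f.comp _).IsOver S)

/-! ### Lifts of the generic point -/

/-- A section of `π` over the generic point of `X` whose image is dense makes `π` birational. -/
theorem isBirationalMorphism_of_generic_section {S X Y : Scheme.{u}} [IsIntegral X] [IsIntegral Y]
    (sX : X ⟶ S) [IsSeparated sX] (sY : Y ⟶ S) [IsSeparated sY] [LocallyOfFiniteType sY]
    (π : Y ⟶ X) (hπ : π ≫ sX = sY) (t : Spec X.functionField ⟶ Y) [IsDominant t]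
    (ht : t ≫ π = X.fromSpecStalk (genericPoint X)) : IsBirationalMorphism π := by
  have hts : t ≫ sY = X.fromSpecStalk (genericPoint X) ≫ sX := by
    rw [← hπ, reassoc_of% ht]
  -- Finite type lets `t` spread out to a morphism on an open neighbourhood of the generic point.
  let ψ := Scheme.PartialMap.ofFromSpecStalk sX sY t hts
  let U := ψ.domain
  have hU : genericPoint X ∈ U := Scheme.PartialMap.mem_domain_ofFromSpecStalk sX sY t hts
  have hψS : ψ.hom ≫ sY = U.ι ≫ sX := Scheme.PartialMap.ofFromSpecStalk_comp sX sY t hts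
  have hψt : U.fromSpecStalkOfMem _ hU ≫ ψ.hom = t :=
    Scheme.PartialMap.fromSpecStalkOfMem_ofFromSpecStalk sX sY t hts
  have hdom : IsDominant (U.fromSpecStalkOfMem _ hU) := by
    have : IsDominant (U.fromSpecStalkOfMem _ hU ≫ U.ι) := by
      rw [Scheme.Opens.fromSpecStalkOfMem_ι]; infer_instance
    exact IsDominant.of_comp_of_isOpenImmersion _ U.ι
  have hsec : ψ.hom ≫ π = U.ι := by
    refine ext_of_isDominant_of_isSeparated sX (by rw [Category.assoc, hπ, hψS])
      (U.fromSpecStalkOfMem _ hU) ?_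
    rw [reassoc_of% hψt, ht, Scheme.Opens.fromSpecStalkOfMem_ι]
  let V := π ⁻¹ᵁ U
  have hle : Set.range ψ.hom ⊆ Set.range V.ι := by
    rw [Scheme.Opens.range_ι]
    rintro _ ⟨x, rfl⟩
    change π (ψ.hom x) ∈ U
    rw [← Scheme.Hom.comp_apply, hsec]
    exact x.2
  let ψ' : U.toScheme ⟶ V.toScheme := IsOpenImmersion.lift V.ι ψ.hom hle
  have hψ' : ψ' ≫ V.ι = ψ.hom := IsOpenImmersion.lift_fac _ _ _
  have h1 : ψ' ≫ (π ∣_ U) = 𝟙 _ := by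
    rw [← cancel_mono U.ι, Category.assoc, morphismRestrict_ι, reassoc_of% hψ', hsec,
      Category.id_comp]
  have hdom' : IsDominant (U.fromSpecStalkOfMem _ hU ≫ ψ') := by
    have : IsDominant ((U.fromSpecStalkOfMem _ hU ≫ ψ') ≫ V.ι) := by
      rw [Category.assoc, hψ', hψt]; infer_instance
    exact IsDominant.of_comp_of_isOpenImmersion _ V.ι
  -- Density of `t` makes the section a two-sided inverse: both sides agree at a dense point of a
  -- separated scheme.
  have h2 : (π ∣_ U) ≫ ψ' = 𝟙 _ := by
    rw [← cancel_mono V.ι, Category.id_comp]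
    refine ext_of_isDominant_of_isSeparated sY ?_ (U.fromSpecStalkOfMem _ hU ≫ ψ') ?_
    · rw [Category.assoc, Category.assoc, reassoc_of% hψ', hψS, morphismRestrict_ι_assoc, hπ]
    · simp only [Category.assoc]
      rw [reassoc_of% h1]
  exact ⟨⟨V, V.2.dense ⟨_, (ψ' ⟨_, hU⟩).2⟩, U, ψ.dense_domain, ⟨π ∣_ U, ψ', h2, h1⟩⟩,
    morphismRestrict_ι _ _⟩

/-- Rational maps out of `Y` can be compared after precomposition with a dense point. -/
theorem toRationalMap_eq_comp_of_dense_point {S X Y : Scheme.{u}} [IsIntegral X]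
    [IsIntegral Y] [X.Over S] [Y.Over S] [IsSeparated (X ↘ S)] (Φ : X ⤏ X) [Φ.IsOver S]
    {σ : Spec X.functionField ⟶ Spec X.functionField}
    (hσ : σ ≫ X.fromSpecStalk (genericPoint X) = Φ.fromFunctionField)
    (π : Y ⟶ X) [IsDominant π] [π.IsOver S] (F : Y ⟶ Y) [F.IsOver S]
    (t : Spec X.functionField ⟶ Y) [IsDominant t]
    (ht : t ≫ π = X.fromSpecStalk (genericPoint X)) (hF : t ≫ F = σ ≫ t) :
    Scheme.Hom.toRationalMap (F ≫ π) = (Scheme.Hom.toRationalMap π).comp Φ := by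
  apply Scheme.RationalMap.eq_of_fromFunctionField_eq
  obtain ⟨α, hα⟩ := exists_eq_comp_fromSpecStalk_genericPoint (Field.toIsField Y.functionField)
    (Scheme.Hom.toRationalMap π).fromFunctionField
  obtain ⟨τ, hτ⟩ := exists_eq_comp_fromSpecStalk_genericPoint (Field.toIsField X.functionField) t
  rw [fromFunctionField_comp _ _ hα]
  rw [fromFunctionField_toRationalMap_hom] at hα ⊢
  have hτα : τ ≫ α = 𝟙 _ := by
    rw [← cancel_mono (X.fromSpecStalk (genericPoint X)), Category.assoc, hα, reassoc_of% hτ, ht,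
      Category.id_comp]
  have : IsDominant τ := by
    have : Subsingleton (Spec Y.functionField) :=
      inferInstanceAs (Subsingleton (PrimeSpectrum Y.functionField))
    exact ⟨(Function.surjective_to_subsingleton _).denseRange⟩
  refine ext_of_isDominant_of_isSeparated (X ↘ S) ?_ τ ?_
  · rw [Category.assoc, Category.assoc, Category.assoc, fromFunctionField_comp_over, reassoc_of% hα]
    simp
  · rw [reassoc_of% hτα, reassoc_of% hτ, reassoc_of% hF, ht, hσ]

/-- A compatible pair of endomorphisms of `Spec L` and `P` lifts to the normalization of `P`
in `Spec L`. -/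
theorem exists_normalization_lift {Y P : Scheme.{u}} (g : Y ⟶ P) [QuasiCompact g]
    [QuasiSeparated g] (σ : Y ⟶ Y) (φ : P ⟶ P) (h : σ ≫ g = g ≫ φ) :
    ∃ F : g.normalization ⟶ g.normalization, g.toNormalization ≫ F = σ ≫ g.toNormalization ∧
      F ≫ g.fromNormalization = g.fromNormalization ≫ φ := by
  -- The base change of the normalization along `φ` is integral over `P` and `g` factors through it,
  -- so the universal property applies.
  let l : Y ⟶ Limits.pullback g.fromNormalization φ :=
    Limits.pullback.lift (σ ≫ g.toNormalization) g (by simpa using h)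
  have hl : g = l ≫ Limits.pullback.snd g.fromNormalization φ :=
    (Limits.pullback.lift_snd _ _ _).symm
  refine ⟨g.normalizationDesc l _ hl ≫ Limits.pullback.fst g.fromNormalization φ, ?_, ?_⟩
  · rw [g.toNormalization_normalizationDesc_assoc l _ hl]
    exact Limits.pullback.lift_fst _ _ _
  · rw [Category.assoc, Limits.pullback.condition, g.normalizationDesc_comp_assoc l _ hl]

end AlgebraicGeometry

/-! ### Construction of the regular model -/

theorem proposition7p1 {K : Type u} [Field K] [IsAlgClosed K] (X : Variety K)
    (Φ : X.toScheme ⤏ X.toScheme) [Φ.IsOver (Spec (CommRingCat.of K))] [Φ.IsDominant]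
    (k : ℕ) (hk : 1 ≤ k) (hreg : IsRegularRationalMap (rationalIterate Φ k)) :
    ∃ (Xhat : Variety K) (π : Xhat.toScheme ⟶ X.toScheme) (_ : IsBirationalMorphism π)
      (F : Xhat.toScheme ⟶ Xhat.toScheme),
      IsNormalScheme Xhat.toScheme ∧
      π.IsOver (Spec (CommRingCat.of K)) ∧
      F.IsOver (Spec (CommRingCat.of K)) ∧
      Scheme.Hom.toRationalMap (F ≫ π) = (Scheme.Hom.toRationalMap π).comp Φ ∧
      (IsProper (X.toScheme ↘ Spec (CommRingCat.of K)) → IsProper π) := by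
  obtain ⟨m, rfl⟩ : ∃ m, k = m + 1 := ⟨k - 1, by omega⟩
  obtain ⟨f, hf⟩ := hreg
  let S := Spec (CommRingCat.of K)
  let sX := X.toScheme ↘ S
  let L := X.toScheme.functionField
  have hL : IsField L := Field.toIsField L
  let j := X.toScheme.fromSpecStalk (genericPoint X.toScheme)
  let q (i : ℕ) : Spec L ⟶ X.toScheme := (rationalIterate Φ i).fromFunctionField
  have hq (i : ℕ) : q i ≫ sX = j ≫ sX := fromFunctionField_comp_over _
  have hq0 : q 0 = j := fromFunctionField_id _
  have hqf : q (m + 1) = j ≫ f := by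
    rw [← fromFunctionField_toRationalMap_hom, hf]
  -- `f` is not given over `K`; this follows from agreement at the generic point.
  have hfS : f ≫ sX = sX := by
    refine ext_of_isDominant j ?_
    rw [← Category.assoc, ← hqf, hq]
  obtain ⟨σ, hσ⟩ := exists_eq_comp_fromSpecStalk_genericPoint hL Φ.fromFunctionField
  have hσq (i : ℕ) : σ ≫ q i = q (i + 1) := (fromFunctionField_comp Φ _ hσ).symm
  obtain ⟨P, s, pr, hpr, hQ, hlift⟩ := exists_fiberPower sX (m + 1)
  have : IsSeparated s := hQ @IsSeparated inferInstance inferInstance inferInstance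
  have : LocallyOfFiniteType s := hQ @LocallyOfFiniteType inferInstance inferInstance inferInstance
  have : QuasiCompact s := hQ @QuasiCompact inferInstance inferInstance inferInstance
  obtain ⟨g, ⟨hgs, hgpr⟩, hguniq⟩ := hlift (Spec L) (j ≫ sX) (fun i ↦ q i) fun i ↦ hq i
  -- The shift: `Φ^k = f` closes up the last coordinate.
  obtain ⟨φ, ⟨hφs, hφpr⟩, -⟩ := hlift P s (Fin.snoc (fun i ↦ pr i.succ) (pr 0 ≫ f)) fun i ↦ by
    refine Fin.lastCases ?_ (fun i ↦ ?_) i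
    · simp [hfS, hpr]
    · simp [hpr]
  have hg0 : g ≫ pr 0 = j := (hgpr 0).trans hq0
  have hσg : σ ≫ g = g ≫ φ := by
    have hex := hlift (Spec L) (j ≫ sX) (fun i ↦ q (i + 1)) fun i ↦ hq (i + 1)
    refine hex.unique ⟨?_, fun i ↦ ?_⟩ ⟨?_, fun i ↦ ?_⟩
    · rw [Category.assoc, hgs, ← hq 0, reassoc_of% hσq, hq, hq]
    · rw [Category.assoc, hgpr, hσq]
    · rw [Category.assoc, hφs, hgs]
    · rw [Category.assoc, hφpr]
      refine Fin.lastCases ?_ (fun i ↦ ?_) i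
      · simp [reassoc_of% hg0, hqf]
      · simp [hgpr]
  have : P.IsSeparated := ⟨by
    rw [← Limits.terminal.comp_from s]; infer_instance⟩
  -- The zeroth coordinate of `g` is the generic point of `X`, so `L` is already the residue field
  -- at the image of `g`.
  have : SurjectiveOnStalks g := by
    have : SurjectiveOnStalks (g ≫ pr 0) := by rw [hg0]; infer_instance
    exact SurjectiveOnStalks.of_comp g (pr 0)
  have hfin : IsFinite g.fromNormalization := isFinite_fromNormalization g hL s
  obtain ⟨F, htF, hFν⟩ := exists_normalization_lift g σ φ hσg
  let Xhat : Variety K :=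
    { toScheme := g.normalization
      overSpec := ⟨g.fromNormalization ≫ s⟩
      isSeparated := inferInstanceAs (IsSeparated (g.fromNormalization ≫ s))
      locallyOfFiniteType := inferInstanceAs (LocallyOfFiniteType (g.fromNormalization ≫ s))
      quasiCompact := inferInstanceAs (QuasiCompact (g.fromNormalization ≫ s)) }
  let π : Xhat.toScheme ⟶ X.toScheme := g.fromNormalization ≫ pr 0
  let : Xhat.toScheme.Over S := Xhat.overSpec
  have hπS : π ≫ sX = Xhat.toScheme ↘ S := by
    rw [Category.assoc, hpr]; rfl
  have hπ : π.IsOver S := ⟨hπS⟩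
  have hF : Scheme.Hom.IsOver (X := Xhat.toScheme) (Y := Xhat.toScheme) F S := ⟨by
    change F ≫ g.fromNormalization ≫ s = g.fromNormalization ≫ s
    rw [reassoc_of% hFν, hφs]⟩
  have : IsSeparated (Xhat.toScheme ↘ S) := Xhat.isSeparated
  have : LocallyOfFiniteType (Xhat.toScheme ↘ S) := Xhat.locallyOfFiniteType
  let t : Spec L ⟶ Xhat.toScheme := g.toNormalization
  have : IsDominant t := inferInstanceAs (IsDominant g.toNormalization)
  have htπ : t ≫ π = j := by
    change g.toNormalization ≫ g.fromNormalization ≫ pr 0 = j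
    rw [g.toNormalization_fromNormalization_assoc, hg0]
  have hbir : IsBirationalMorphism π :=
    isBirationalMorphism_of_generic_section sX (Xhat.toScheme ↘ S) π hπS t htπ
  refine ⟨Xhat, π, hbir, F, isNormalScheme_normalization g hL, hπ, hF,
    toRationalMap_eq_comp_of_dense_point (S := S) Φ hσ π F t htπ htF, fun hX ↦ ?_⟩
  -- `X̂` is finite over the proper `P`, and properness of `π` follows by cancelling the separated
  -- `sX`.
  have : IsProper s := hQ @IsProper inferInstance inferInstance hX
  have : IsProper (π ≫ sX) := by
    rw [hπS]
    exact inferInstanceAs (IsProper (g.fromNormalization ≫ s))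
  exact IsProper.of_comp π sX
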